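/- Let $A$ and $B$ be finitely generated groups, let $G = A \times B$ with projections $\pi_A \colon G \to A$ and $\pi_B \colon G \to B$, and let $H$ be a subgroup of $G$ of finite index $[G:H]$. For a group $K$ let $K^{\mathrm{ab}} = K/[K,K]$ denote its abelianization, and for an abelian group $M$ let $t(M)$ denote its torsion subgroup. Then $t(H^{\mathrm{ab}})$ is finite and $$|t(H^{\mathrm{ab}})| \le |t(\pi_A(H)^{\mathrm{ab}})| \cdot |t(\pi_B(H)^{\mathrm{ab}})| \cdot [G:H]^{2(1+\log [G:H])},$$ where $\log$ is the natural logarithm. -/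

import Mathlib

open Subgroup
open scoped commutatorElement

/-! Let `M` and `N` be the kernels of the two projections of `H`. They meet trivially, and `M ⊔ N`
has index at most `[G:H]` in `H`. The map from `H^ab` to the product of the abelianized projections
has as kernel the image of `M ⊓ ([H,H] ⊔ N)`, so it suffices to bound that image.

Modulo `⁅M, ⊤⁆ ⊔ N` the subgroup `M` becomes central of finite index, which reduces to a Schur-type
bound: if `Z` is central of index `k`, then `|Z ∩ [G,G]| ≤ k ^ log₂ k`. This is proved prime by
prime, with transfer to the preimage of a Sylow subgroup of `G/Z`
(`factorization_card_inf_commutator_le`). -/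

theorem finite_torsion_of_fg (G : Type*) [CommGroup G] [Group.FG G] :
    Finite (CommGroup.torsion G) := by
  have : Module.Finite ℤ (Additive G) := Module.Finite.iff_addGroup_fg.mpr inferInstance
  have h := IsNoetherian.noetherian
    (AddSubgroup.toIntSubmodule (Subgroup.toAddSubgroup (CommGroup.torsion G)))
  rw [Submodule.fg_iff_addSubgroup_fg] at h
  have h' : (CommGroup.torsion G).FG := (Subgroup.fg_iff_add_fg _).mpr h
  have : Group.FG (CommGroup.torsion G) := (Group.fg_iff_subgroup_fg _).mpr h'
  exact CommGroup.finite_of_fg_isMulTorsion _ (fun x ↦ Submonoid.isOfFinOrder_coe.mp x.2)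

/-! ### Commutators over a central subgroup of finite index -/

theorem finite_commutator_of_finiteIndex_central {G : Type*} [Group G] {Z : Subgroup G}
    [Z.FiniteIndex] (hZ : Z ≤ center G) : Finite (commutator G) := by
  have hmem : ∀ g : G, ∃ z ∈ Z, (g : G ⧸ Z).out = g * z := fun g ↦
    let ⟨z, hz⟩ := QuotientGroup.mk_out_eq_mul Z g
    ⟨z, z.2, hz⟩
  have : Finite (G ⧸ Z) := inferInstance
  have : (commutatorSet G).Finite := by
    refine (Set.finite_range fun x : (G ⧸ Z) × (G ⧸ Z) ↦ ⁅x.1.out, x.2.out⁆).subset ?_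
    rintro _ ⟨a, b, rfl⟩
    obtain ⟨y, hy, hay⟩ := hmem a
    obtain ⟨z, hz, hbz⟩ := hmem b
    refine ⟨(a, b), ?_⟩
    have hy' := mem_center_iff.mp (hZ hy)
    have hz' := mem_center_iff.mp (hZ hz)
    simp only [hay, hbz, commutatorElement_def, mul_inv_rev]
    calc a * y * (b * z) * (y⁻¹ * a⁻¹) * (z⁻¹ * b⁻¹)
        = a * ((y * (b * z)) * y⁻¹) * a⁻¹ * (z⁻¹ * b⁻¹) := by group
      _ = a * (b * (z * a⁻¹)) * (z⁻¹ * b⁻¹) := by rw [← hy']; group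
      _ = a * b * a⁻¹ * b⁻¹ := by rw [← hz']; group
  have := this.to_subtype
  infer_instance

/-- If `x` is central modulo a central subgroup `Z`, then `y ↦ ⁅x, y⁆` is a homomorphism. -/
def commutatorHom {G : Type*} [Group G] {Z : Subgroup G} (hZ : Z ≤ center G) (x : G)
    (hx : ∀ y, ⁅x, y⁆ ∈ Z) : G →* G where
  toFun y := ⁅x, y⁆
  map_one' := commutatorElement_one_right x
  map_mul' y z := by
    have h := mem_center_iff.mp (hZ (hx z)) y
    calc ⁅x, y * z⁆ = ⁅x, y⁆ * (y * ⁅x, z⁆) * y⁻¹ := by simp only [commutatorElement_def]; group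
      _ = ⁅x, y⁆ * ⁅x, z⁆ := by rw [h]; group

/-- Choose `x` whose image is central of order `p` in `G ⧸ Z`. The image of `y ↦ ⁅x, y⁆` has order
at most `p ^ m`; modulo it, `⟨x, Z⟩` is central of index `p ^ m`, and induction applies. -/
theorem card_commutator_le_of_index_eq_prime_pow {p : ℕ} [Fact p.Prime] (m : ℕ) :
    ∀ {G : Type*} [Group G] (Z : Subgroup G), Z ≤ center G → Z.index = p ^ m →
      Nat.card (commutator G) ≤ p ^ (m * m) := by
  have hp : p.Prime := Fact.out
  induction m with
  | zero =>
    intro G _ Z hZ hi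
    rw [pow_zero, index_eq_one] at hi
    have hc : center G = ⊤ := top_le_iff.mp (hi ▸ hZ)
    have : commutator G = ⊥ := by
      rw [commutator_def, commutator_eq_bot_iff_le_centralizer, ← hc]
      exact fun x hx ↦ Subgroup.center_le_centralizer _ hx
    simp [this]
  | succ m ih =>
    intro G _ Z hZ hi
    have : Z.Normal := ⟨fun z hz g ↦ by
      rw [mem_center_iff.mp (hZ hz) g]; simpa using hz⟩
    have : Z.FiniteIndex := ⟨by rw [hi]; exact pow_ne_zero _ hp.ne_zero⟩
    have : Finite (G ⧸ Z) := inferInstance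
    have hcard : Nat.card (G ⧸ Z) = p ^ (m + 1) := hi
    have hpG : IsPGroup p (G ⧸ Z) := IsPGroup.of_card hcard
    have : Nontrivial (G ⧸ Z) := by
      rw [← Finite.one_lt_card_iff_nontrivial, hcard]
      exact Nat.one_lt_pow (by omega) hp.one_lt
    have hnt : Nontrivial (center (G ⧸ Z)) := hpG.center_nontrivial
    have hdvd : p ∣ Nat.card (center (G ⧸ Z)) := by
      obtain ⟨k, hk, h⟩ := (hpG.to_subgroup (center (G ⧸ Z))).nontrivial_iff_card.mp hnt
      rw [h]; exact dvd_pow_self p hk.ne'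
    obtain ⟨⟨xbar, hxc⟩, hxo⟩ := exists_prime_orderOf_dvd_card' p hdvd
    obtain ⟨x, rfl⟩ := QuotientGroup.mk_surjective xbar
    rw [Subgroup.orderOf_mk] at hxo
    have hx : ∀ y, ⁅x, y⁆ ∈ Z := fun y ↦ by
      rw [← QuotientGroup.eq_one_iff, ← QuotientGroup.mk'_apply, map_commutatorElement,
        commutatorElement_eq_one_iff_mul_comm]
      exact (mem_center_iff.mp hxc _).symm
    let c := commutatorHom hZ x hx
    have hcapp : ∀ y, c y = ⁅x, y⁆ := fun _ ↦ rfl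
    -- the preimage of `⟨x⟩` has index `p ^ m` and is killed by `c`
    let Y : Subgroup G := (zpowers (x : G ⧸ Z)).comap (QuotientGroup.mk' Z)
    have hYi : Y.index = p ^ m := by
      rw [index_comap_of_surjective _ (QuotientGroup.mk'_surjective Z)]
      have h := (zpowers (x : G ⧸ Z)).card_mul_index
      rw [Nat.card_zpowers, hxo, hcard, pow_succ'] at h
      exact Nat.eq_of_mul_eq_mul_left hp.pos h
    have hY : ∀ y ∈ Y, ∃ k : ℤ, ∃ z ∈ Z, y = x ^ k * z := by
      intro y hy
      obtain ⟨k, hk⟩ := mem_zpowers_iff.mp (mem_comap.mp hy)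
      refine ⟨k, x ^ (-k) * y, ?_, by group⟩
      rw [← QuotientGroup.eq_one_iff]
      simp only [QuotientGroup.mk'_apply] at hk
      simp [← hk]
    have hYker : Y ≤ c.ker := by
      intro y hy
      obtain ⟨k, z, hz, rfl⟩ := hY y hy
      rw [MonoidHom.mem_ker, hcapp, commutatorElement_eq_one_iff_mul_comm]
      have h := mem_center_iff.mp (hZ hz) x
      rw [mul_assoc, ← h]; group
    have hrange_le : Nat.card c.range ≤ p ^ m := by
      rw [← index_ker, ← hYi]
      have : Y.FiniteIndex := ⟨by rw [hYi]; exact pow_ne_zero _ hp.ne_zero⟩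
      exact index_antitone hYker
    have hRZ : c.range ≤ Z := by rintro _ ⟨y, rfl⟩; exact hx y
    have hRn : c.range.Normal := ⟨fun z hz g ↦ by
      rw [mem_center_iff.mp (hZ (hRZ hz)) g]; simpa using hz⟩
    let q := QuotientGroup.mk' c.range
    have hq : Function.Surjective q := QuotientGroup.mk'_surjective _
    have hkq : q.ker = c.range := QuotientGroup.ker_mk' _
    have hYc : Y.map q ≤ center _ := by
      rintro _ ⟨y, hy, rfl⟩
      obtain ⟨k, z, hz, rfl⟩ := hY y hy
      rw [map_mul, map_zpow]
      refine mul_mem (zpow_mem ?_ k) ?_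
      · rw [mem_center_iff]
        intro w
        obtain ⟨w, rfl⟩ := hq w
        have : q ⁅x, w⁆ = 1 := by
          rw [← MonoidHom.mem_ker, hkq]; exact ⟨w, rfl⟩
        rw [map_commutatorElement, commutatorElement_eq_one_iff_mul_comm] at this
        exact this.symm
      · rw [mem_center_iff]
        intro w
        obtain ⟨w, rfl⟩ := hq w
        rw [← map_mul, ← map_mul, mem_center_iff.mp (hZ hz) w]
    have hZY : Z ≤ Y := fun z hz ↦ by
      rw [mem_comap, QuotientGroup.mk'_apply, (QuotientGroup.eq_one_iff z).mpr hz]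
      exact one_mem _
    have hi' : (Y.map q).index = p ^ m := by
      rw [index_map_eq _ hq (by rw [hkq]; exact hRZ.trans hZY), hYi]
    have hind := ih (Y.map q) hYc hi'
    have hRC : c.range ≤ commutator G := by
      rintro _ ⟨y, rfl⟩
      exact commutator_mem_commutator (mem_top x) (mem_top y)
    have hmul := relIndex_mul_relIndex ⊥ c.range (commutator G) bot_le hRC
    rw [relIndex_bot_left, relIndex_bot_left] at hmul
    have hquot : c.range.relIndex (commutator G) = Nat.card (commutator (G ⧸ c.range)) := by
      conv_lhs => rw [← hkq]
      rw [relIndex_ker, commutator_def, map_commutator, commutator_def,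
        map_top_of_surjective _ hq]
    rw [← hmul, hquot]
    calc _ ≤ p ^ m * p ^ (m * m) := Nat.mul_le_mul hrange_le hind
      _ = p ^ (m + m * m) := (pow_add _ _ _).symm
      _ ≤ p ^ ((m + 1) * (m + 1)) := Nat.pow_le_pow_right hp.pos (by nlinarith)

/-- Transfer to the abelianization of `P` kills commutators and raises central elements to the power
`P.index`. -/
theorem pow_index_mem_map_commutator_of_mem_center {G : Type*} [Group G] (P : Subgroup G)
    [P.FiniteIndex] {z : G} (hz : z ∈ center G) (hz' : z ∈ commutator G) :
    z ^ P.index ∈ (commutator P).map P.subtype := by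
  have key : ∀ (k : ℕ) (g : G), g⁻¹ * z ^ k * g ∈ P → g⁻¹ * z ^ k * g = z ^ k := by
    intro k g _
    rw [mul_assoc, ← mem_center_iff.mp (pow_mem hz k) g, inv_mul_cancel_left]
  have h := MonoidHom.transfer_eq_pow (Abelianization.of : P →* _) z key
  have h1 : MonoidHom.transfer (Abelianization.of : P →* _) z = 1 :=
    Abelianization.commutator_subset_ker _ hz'
  rw [h1, eq_comm, ← MonoidHom.mem_ker, Abelianization.ker_of] at h
  exact ⟨_, h, rfl⟩

theorem factorization_card_inf_commutator_le {G : Type*} [Group G] {Z : Subgroup G}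
    [Z.FiniteIndex] (hZ : Z ≤ center G) {p : ℕ} (hp : p.Prime) :
    (Nat.card (Z ⊓ commutator G : Subgroup G)).factorization p ≤
      Z.index.factorization p * Z.index.factorization p := by
  have := Fact.mk hp
  have : Z.Normal := ⟨fun z hz g ↦ by
    rw [mem_center_iff.mp (hZ hz) g]; simpa using hz⟩
  have : Finite (G ⧸ Z) := inferInstance
  have := finite_commutator_of_finiteIndex_central hZ
  have : Finite (Z ⊓ commutator G : Subgroup G) :=
    Finite.of_injective _ (inclusion_injective (inf_le_right : Z ⊓ commutator G ≤ _))
  obtain ⟨S⟩ : Nonempty (Sylow p (G ⧸ Z)) := inferInstance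
  let P : Subgroup G := (S : Subgroup (G ⧸ Z)).comap (QuotientGroup.mk' Z)
  have hPi : P.index = (S : Subgroup (G ⧸ Z)).index :=
    index_comap_of_surjective _ (QuotientGroup.mk'_surjective Z)
  have : P.FiniteIndex := ⟨by rw [hPi]; exact FiniteIndex.index_ne_zero⟩
  have hpP : p.Coprime P.index := by
    rw [hPi]; exact (Nat.Prime.coprime_iff_not_dvd hp).mpr S.not_dvd_index
  have hZP : Z ≤ P := fun z hz ↦ by
    rw [mem_comap, QuotientGroup.mk'_apply, (QuotientGroup.eq_one_iff z).mpr hz]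
    exact one_mem _
  have hZPi : (Z.subgroupOf P).index = p ^ Z.index.factorization p := by
    have h1 : Z.relIndex P * P.index = Z.index := relIndex_mul_index hZP
    have h2 : Nat.card S * (S : Subgroup (G ⧸ Z)).index = Z.index :=
      (S : Subgroup (G ⧸ Z)).card_mul_index
    have h3 : Nat.card S = p ^ Z.index.factorization p := S.card_eq_multiplicity
    rw [← h3]
    rw [hPi, ← h2] at h1
    exact Nat.eq_of_mul_eq_mul_right (Nat.pos_of_ne_zero FiniteIndex.index_ne_zero) h1
  have hZPc : Z.subgroupOf P ≤ center P := fun z hz ↦ mem_center_iff.mpr fun g ↦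
    Subtype.ext (mem_center_iff.mp (hZ (mem_subgroupOf.mp hz)) g)
  have hbound := card_commutator_le_of_index_eq_prime_pow _ _ hZPc hZPi
  obtain ⟨T⟩ : Nonempty (Sylow p (Z ⊓ commutator G : Subgroup G)) := inferInstance
  have hT : (T : Subgroup _).map (Z ⊓ commutator G).subtype ≤ (commutator P).map P.subtype := by
    rintro _ ⟨t, ht, rfl⟩
    have h := pow_index_mem_map_commutator_of_mem_center P (hZ t.2.1) t.2.2
    obtain ⟨k, hk⟩ := T.2 ⟨t, ht⟩
    have hk' : (t : G) ^ p ^ k = 1 := by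
      have := congrArg (fun s : T ↦ ((s : (Z ⊓ commutator G : Subgroup G)) : G)) hk
      simpa using this
    -- As `t` has `p`-power order, it is a power of `t ^ P.index`.
    have hco : (orderOf (t : G)).Coprime P.index :=
      Nat.Coprime.coprime_dvd_left (orderOf_dvd_of_pow_eq_one hk') (hpP.pow_left k)
    obtain ⟨j, hj⟩ := exists_pow_eq_self_of_coprime hco.symm
    rw [Subgroup.subtype_apply, ← hj]
    exact pow_mem h j
  have : Finite (commutator P) :=
    have : (Z.subgroupOf P).FiniteIndex := ⟨by rw [hZPi]; exact pow_ne_zero _ hp.ne_zero⟩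
    finite_commutator_of_finiteIndex_central hZPc
  have : Finite ((commutator P).map P.subtype) :=
    Finite.of_equiv _ (equivMapOfInjective _ _ (subtype_injective P)).toEquiv
  have hcard := Nat.card_le_card_of_injective _ (inclusion_injective hT)
  rw [card_map_of_injective (subtype_injective _), card_map_of_injective (subtype_injective _),
    T.card_eq_multiplicity] at hcard
  exact (Nat.pow_le_pow_iff_right hp.one_lt).mp (hcard.trans hbound)

theorem card_inf_commutator_le_pow_log {G : Type*} [Group G] {Z : Subgroup G}
    [Z.FiniteIndex] (hZ : Z ≤ center G) :
    Nat.card (Z ⊓ commutator G : Subgroup G) ≤ Z.index ^ Nat.log 2 Z.index := by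
  have := finite_commutator_of_finiteIndex_central hZ
  have : Finite (Z ⊓ commutator G : Subgroup G) :=
    Finite.of_injective _ (inclusion_injective (inf_le_right : Z ⊓ commutator G ≤ _))
  have hn : Z.index ≠ 0 := FiniteIndex.index_ne_zero
  refine Nat.le_of_dvd (pow_pos (Nat.pos_of_ne_zero hn) _) ?_
  rw [← Nat.factorization_prime_le_iff_dvd Nat.card_pos.ne' (pow_ne_zero _ hn)]
  intro p hp
  refine (factorization_card_inf_commutator_le hZ hp).trans ?_
  rw [Nat.factorization_pow, Finsupp.smul_apply, smul_eq_mul]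
  -- If `p ^ e` exactly divides `Z.index`, then `2 ^ e ≤ p ^ e ≤ Z.index`.
  refine Nat.mul_le_mul_right _ (Nat.le_log_of_pow_le one_lt_two ?_)
  exact (Nat.pow_le_pow_left hp.two_le _).trans
    (Nat.le_of_dvd (Nat.pos_of_ne_zero hn) (Nat.ordProj_dvd _ p))

/-! ### Comparison with the two projections -/

/-- Passing to the quotient by `R` loses nothing: `M` meets `N` trivially, so `R ⊓ M` already lies
in `commutator G`. -/
theorem relIndex_commutator_le {G : Type*} [Group G] {M N : Subgroup G} [M.Normal] [N.Normal]
    (hMN : Disjoint M N) [(M ⊔ N).FiniteIndex] :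
    (commutator G).relIndex (M ⊓ (commutator G ⊔ N)) ≠ 0 ∧
      (commutator G).relIndex (M ⊓ (commutator G ⊔ N)) ≤
        (M ⊔ N).index ^ Nat.log 2 (M ⊔ N).index := by
  set X := M ⊓ (commutator G ⊔ N) with hX
  have hMtop : ⁅M, ⊤⁆ ≤ commutator G := commutator_mono le_top le_rfl
  let R := ⁅M, (⊤ : Subgroup G)⁆ ⊔ N
  let q := QuotientGroup.mk' R
  have hq : Function.Surjective q := QuotientGroup.mk'_surjective _
  have hkq : q.ker = R := QuotientGroup.ker_mk' _
  have hRM : R ⊓ M ≤ commutator G := by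
    rintro x ⟨hxR, hxM⟩
    obtain ⟨c, hc, n, hn, rfl⟩ := mem_sup_of_normal_right.mp hxR
    have hnM : n ∈ M := (mul_mem_cancel_left (commutator_le_left M ⊤ hc)).mp hxM
    rw [Subgroup.disjoint_def.mp hMN hnM hn, mul_one]
    exact hMtop hc
  have hRMN : R ≤ M ⊔ N := sup_le_sup_right (commutator_le_left M ⊤) N
  have hmapN : N.map q = ⊥ := by
    rw [Subgroup.map_eq_bot_iff, hkq]; exact le_sup_right
  have hmap : (M ⊔ N).map q = M.map q := by rw [Subgroup.map_sup, hmapN, sup_bot_eq]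
  have hidx : (M.map q).index = (M ⊔ N).index := by
    rw [← hmap, index_map_eq _ hq (hkq.trans_le hRMN)]
  have : (M.map q).FiniteIndex := ⟨by rw [hidx]; exact FiniteIndex.index_ne_zero⟩
  have hcentral : M.map q ≤ center _ := by
    rintro _ ⟨m, hm, rfl⟩
    rw [mem_center_iff]
    intro w
    obtain ⟨w, rfl⟩ := hq w
    have : q ⁅m, w⁆ = 1 := by
      rw [← MonoidHom.mem_ker, hkq]
      exact mem_sup_left (commutator_mem_commutator hm (mem_top w))
    rw [map_commutatorElement, commutatorElement_eq_one_iff_mul_comm] at this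
    exact this.symm
  have hXmap : X.map q ≤ M.map q ⊓ commutator _ := by
    refine le_inf (map_mono inf_le_left) ((map_mono inf_le_right).trans ?_)
    rw [Subgroup.map_sup, hmapN, sup_bot_eq, commutator_def, map_commutator]
    exact commutator_mono le_top le_top
  have := finite_commutator_of_finiteIndex_central hcentral
  have : Finite (M.map q ⊓ commutator _ : Subgroup (G ⧸ R)) :=
    Finite.of_injective _ (inclusion_injective (inf_le_right : M.map q ⊓ commutator _ ≤ _))
  have : Finite (X.map q) := Finite.of_injective _ (inclusion_injective hXmap)
  have hRX : R.relIndex X = Nat.card (X.map q) := by rw [← relIndex_ker, hkq]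
  have hne : (R ⊓ X).relIndex X ≠ 0 := by
    rw [inf_relIndex_right, hRX]; exact Nat.card_pos.ne'
  have hle : R ⊓ X ≤ commutator G := (inf_le_inf_left R inf_le_left).trans hRM
  refine ⟨fun h ↦ hne (relIndex_eq_zero_of_le_left hle h), ?_⟩
  calc (commutator G).relIndex X ≤ (R ⊓ X).relIndex X := relIndex_le_of_le_left hle hne
    _ = Nat.card (X.map q) := by rw [inf_relIndex_right, hRX]
    _ ≤ Nat.card (M.map q ⊓ commutator _ : Subgroup (G ⧸ R)) :=
      Nat.card_le_card_of_injective _ (inclusion_injective hXmap)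
    _ ≤ _ := by rw [← hidx]; exact card_inf_commutator_le_pow_log hcentral

theorem mem_commutator_sup_ker {G G' : Type*} [Group G] [Group G'] {f : G →* G'}
    (hf : Function.Surjective f) {g : G} (hg : f g ∈ commutator G') :
    g ∈ commutator G ⊔ f.ker := by
  rw [commutator_def, ← map_top_of_surjective f hf, ← map_commutator] at hg
  have : g ∈ ((⁅⊤, ⊤⁆ : Subgroup G).map f).comap f := hg
  rwa [comap_map_eq] at this

theorem card_torsion_abelianization_le {G A B : Type*} [Group G] [Group A] [Group B]
    {f : G →* A} {g : G →* B} (hf : Function.Surjective f) (hg : Function.Surjective g)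
    (hfg : Disjoint f.ker g.ker) [(f.ker ⊔ g.ker).FiniteIndex]
    [Finite (CommGroup.torsion (Abelianization A))]
    [Finite (CommGroup.torsion (Abelianization B))] :
    Nat.card (CommGroup.torsion (Abelianization G)) ≤
      Nat.card (CommGroup.torsion (Abelianization A)) *
      Nat.card (CommGroup.torsion (Abelianization B)) *
      (f.ker ⊔ g.ker).index ^ Nat.log 2 (f.ker ⊔ g.ker).index := by
  let Φ := (Abelianization.map f).prod (Abelianization.map g)
  let X := f.ker ⊓ (commutator G ⊔ g.ker)
  let T := CommGroup.torsion (Abelianization G)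
  obtain ⟨hne, hle⟩ := relIndex_commutator_le hfg
  have hcardX : (commutator G).relIndex X = Nat.card (X.map Abelianization.of) := by
    rw [← Abelianization.ker_of, relIndex_ker]
  rw [hcardX] at hne hle
  have : Finite (X.map Abelianization.of) := Nat.finite_of_card_ne_zero hne
  have hker : Φ.ker ≤ X.map Abelianization.of := by
    intro x hx
    obtain ⟨h, rfl⟩ := QuotientGroup.mk_surjective x
    change Abelianization.of h ∈ Φ.ker at hx
    rw [MonoidHom.mem_ker, MonoidHom.prod_apply, Prod.mk_eq_one, Abelianization.map_of,
      Abelianization.map_of, ← MonoidHom.mem_ker, ← MonoidHom.mem_ker, Abelianization.ker_of,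
      Abelianization.ker_of] at hx
    obtain ⟨c, hc, m, hm, rfl⟩ := mem_sup_of_normal_right.mp (mem_commutator_sup_ker hf hx.1)
    have hm' : m ∈ commutator G ⊔ g.ker := by
      have := mul_mem (inv_mem (mem_sup_left hc)) (mem_commutator_sup_ker hg hx.2)
      rwa [inv_mul_cancel_left] at this
    refine ⟨m, ⟨hm, hm'⟩, ?_⟩
    change Abelianization.of m = Abelianization.of (c * m)
    rw [map_mul, show Abelianization.of c = 1 from
      MonoidHom.mem_ker.mp ((Abelianization.ker_of G).ge hc), one_mul]
  have hmap : T.map Φ ≤ (CommGroup.torsion (Abelianization A)).prod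
      (CommGroup.torsion (Abelianization B)) := by
    rintro _ ⟨t, ht, rfl⟩
    exact ⟨MonoidHom.isOfFinOrder _ ht, MonoidHom.isOfFinOrder _ ht⟩
  have : Finite ((CommGroup.torsion (Abelianization A)).prod
      (CommGroup.torsion (Abelianization B))) := Finite.of_equiv _ (prodEquiv _ _).toEquiv.symm
  have hcard : Nat.card T = Nat.card (Φ.ker ⊓ T : Subgroup _) * Nat.card (T.map Φ) := by
    have h := relIndex_mul_relIndex ⊥ (Φ.ker ⊓ T) T bot_le inf_le_right
    rw [relIndex_bot_left, relIndex_bot_left, inf_relIndex_right, relIndex_ker] at h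
    exact h.symm
  change Nat.card T ≤ _
  rw [hcard, mul_comm]
  refine Nat.mul_le_mul ?_ ((Nat.card_le_card_of_injective _
    (inclusion_injective (inf_le_left.trans hker))).trans hle)
  rw [← Nat.card_prod, ← Nat.card_congr (prodEquiv _ _).toEquiv]
  exact Nat.card_le_card_of_injective _ (inclusion_injective hmap)

/-! ### Numerical and index estimates, and the conclusion -/

theorem pow_log_two_le_rpow {k n : ℕ} (hk : k ≠ 0) (hkn : k ≤ n) :
    ((k ^ Nat.log 2 k : ℕ) : ℝ) ≤ (n : ℝ) ^ (2 * (1 + Real.log n)) := by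
  have hn : (1 : ℝ) ≤ n := by exact_mod_cast (Nat.one_le_iff_ne_zero.mpr hk).trans hkn
  have h1 : k ^ Nat.log 2 k ≤ n ^ Nat.log 2 n :=
    (Nat.pow_le_pow_left hkn _).trans (Nat.pow_le_pow_right (by omega) (Nat.log_mono_right hkn))
  refine (Nat.cast_le.mpr h1).trans ?_
  rw [Nat.cast_pow, ← Real.rpow_natCast]
  refine Real.rpow_le_rpow_of_exponent_le hn ?_
  have hlog : 0 ≤ Real.log n := Real.log_nonneg hn
  have h2 : (Nat.log 2 n : ℝ) ≤ Real.logb 2 n := Real.natLog_le_logb n 2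
  have h3 : Real.logb 2 n ≤ 2 * Real.log n := by
    rw [Real.logb, div_le_iff₀ (Real.log_pos one_lt_two)]
    -- Only `2 * log 2 ≥ 1` is needed.
    nlinarith [Real.log_two_gt_d9]
  linarith

theorem index_ker_fst_sup_ker_snd_le {A B : Type*} [Group A] [Group B] (H : Subgroup (A × B))
    [H.FiniteIndex] :
    (((MonoidHom.fst A B).subgroupMap H).ker ⊔ ((MonoidHom.snd A B).subgroupMap H).ker).index ≠ 0 ∧
    (((MonoidHom.fst A B).subgroupMap H).ker ⊔ ((MonoidHom.snd A B).subgroupMap H).ker).index ≤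
      H.index := by
  -- `ψ` sends `(a, b)` to `(1, b)`; if that lies in `H`, so does `(a, 1)`, and `(a, b)` splits into
  -- kernel elements.
  let ψ : H →* A × B := (MonoidHom.inr A B).comp ((MonoidHom.snd A B).comp H.subtype)
  have hle : H.comap ψ ≤
      ((MonoidHom.fst A B).subgroupMap H).ker ⊔ ((MonoidHom.snd A B).subgroupMap H).ker := by
    rintro ⟨⟨a, b⟩, hab⟩ h
    have hb : ((1, b) : A × B) ∈ H := h
    have ha : ((a, 1) : A × B) ∈ H := by simpa using mul_mem hab (inv_mem hb)
    have : (⟨(a, b), hab⟩ : H) = ⟨(1, b), hb⟩ * ⟨(a, 1), ha⟩ := by simp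
    rw [this]
    exact mul_mem (mem_sup_left (Subtype.ext rfl)) (mem_sup_right (Subtype.ext rfl))
  have hi : (H.comap ψ).index = H.relIndex ψ.range := index_comap H ψ
  have hne : (H.comap ψ).index ≠ 0 := by
    rw [hi]; exact fun h ↦ FiniteIndex.index_ne_zero (index_eq_zero_of_relIndex_eq_zero h)
  have : (H.comap ψ).FiniteIndex := ⟨hne⟩
  refine ⟨(finiteIndex_of_le hle).index_ne_zero, (index_antitone hle).trans ?_⟩
  rw [hi, ← relIndex_top_right]
  exact relIndex_le_of_le_right le_top (by rw [relIndex_top_right]; exact FiniteIndex.index_ne_zero)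

theorem finite_torsion_abelianization {G : Type*} [Group G] [Group.FG G] :
    Finite (CommGroup.torsion (Abelianization G)) :=
  have : Group.FG (Abelianization G) :=
    Group.fg_of_surjective (f := (Abelianization.of : G →* _)) QuotientGroup.mk_surjective
  finite_torsion_of_fg _

theorem mainTheorem5 {A B : Type*} [Group A] [Group B] [Group.FG A] [Group.FG B]
    (H : Subgroup (A × B)) [H.FiniteIndex] :
    Finite (CommGroup.torsion (Abelianization H)) ∧
    (Nat.card (CommGroup.torsion (Abelianization H)) : ℝ) ≤
      (Nat.card (CommGroup.torsion (Abelianization (H.map (MonoidHom.fst A B)))) : ℝ) *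
      (Nat.card (CommGroup.torsion (Abelianization (H.map (MonoidHom.snd A B)))) : ℝ) *
      (H.index : ℝ) ^ (2 * (1 + Real.log (H.index : ℝ))) := by
  have : Group.FG H := inferInstance
  refine ⟨finite_torsion_abelianization, ?_⟩
  have hf := (MonoidHom.fst A B).subgroupMap_surjective H
  have hg := (MonoidHom.snd A B).subgroupMap_surjective H
  have : Group.FG (H.map (MonoidHom.fst A B)) := Group.fg_of_surjective hf
  have : Group.FG (H.map (MonoidHom.snd A B)) := Group.fg_of_surjective hg
  have := finite_torsion_abelianization (G := H.map (MonoidHom.fst A B))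
  have := finite_torsion_abelianization (G := H.map (MonoidHom.snd A B))
  obtain ⟨hne, hle⟩ := index_ker_fst_sup_ker_snd_le H
  have := FiniteIndex.mk hne
  have hdisj : Disjoint ((MonoidHom.fst A B).subgroupMap H).ker
      ((MonoidHom.snd A B).subgroupMap H).ker := by
    rw [Subgroup.disjoint_def]
    intro x hx hy
    exact Subtype.ext (Prod.ext (congrArg Subtype.val hx) (congrArg Subtype.val hy))
  have h := card_torsion_abelianization_le hf hg hdisj
  refine (Nat.cast_le.mpr h).trans ?_
  rw [Nat.cast_mul, Nat.cast_mul]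
  exact mul_le_mul_of_nonneg_left (pow_log_two_le_rpow hne hle) (by positivity)
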